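/- Let $H_0,H_1,H_2,\dots$ be the Hermite polynomials, $H_0(x)=1$, $H_{j+1}(x)=2xH_j(x)-H_j'(x)$, which are orthogonal on $\mathbb R$ with respect to the weight $e^{-x^2}$. For $n\ge 0$ let $$\Pi_n(x)=\sum_{j=0}^n \hat s_j\,H_j(x),\qquad \hat s_j=\frac{\int_{-\infty}^{\infty}\operatorname{sgn}(x)\,H_j(x)\,e^{-x^2}\,dx}{\int_{-\infty}^{\infty}H_j(x)^2\,e^{-x^2}\,dx},$$ be the expansion of the sign function in the Hermite polynomials, truncated at degree $n$. Then for every $n\ge 3$ the polynomial $\Pi_n$ has a smallest positive critical point $x_{n,+}$, and $$\lim_{n\to\infty}\Pi_n(x_{n,+})=\frac{2}{\pi}\int_0^{\pi}\frac{\sin t}{t}\,dt .$$ -/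

import Mathlib

open Polynomial MeasureTheory Filter Topology

noncomputable section

/-- The (physicists') Hermite polynomials `H₀ = 1`, `Hₙ₊₁ = 2 X Hₙ - Hₙ'`, which are the orthogonal
polynomials on `ℝ` for the weight `exp (-x ^ 2)`. (Mathlib's `Polynomial.hermite` is the
probabilists' family, for the weight `exp (-x ^ 2 / 2)`.) -/
def hermiteH : ℕ → ℝ[X]
  | 0 => 1
  | n + 1 => 2 * X * hermiteH n - derivative (hermiteH n)

/-- The weighted inner product `⟨f, g⟩ = ∫ f(x) g(x) exp (-x ^ 2) dx` over `ℝ`. -/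
def hermiteInner (f g : ℝ → ℝ) : ℝ :=
  ∫ x : ℝ, f x * g x * Real.exp (-x ^ 2)

/-- The `j`-th Hermite coefficient `⟨f, H_j⟩ / ‖H_j‖ ^ 2` of `f`. -/
def hermiteCoeff (f : ℝ → ℝ) (j : ℕ) : ℝ :=
  hermiteInner f (fun x => (hermiteH j).eval x) /
    hermiteInner (fun x => (hermiteH j).eval x) (fun x => (hermiteH j).eval x)

/-- The Hermite expansion of `f` truncated at degree `n`. -/
def hermiteExpansion (f : ℝ → ℝ) (n : ℕ) (x : ℝ) : ℝ :=
  ∑ j ∈ Finset.range (n + 1), hermiteCoeff f j * (hermiteH j).eval x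

/-- `x` is the smallest positive critical point of `f`. -/
def IsSmallestPosCriticalPoint (f : ℝ → ℝ) (x : ℝ) : Prop :=
  IsLeast {y : ℝ | 0 < y ∧ DifferentiableAt ℝ f y ∧ deriv f y = 0} x

end

/-! Since `H_{j+1} e^{-x²} = -(H_j e^{-x²})'`, the coefficient of `sgn` on `H_{j+1}` is a multiple
of `H_j(0)`. With `H_{j+1}' = 2(j+1) H_j`, this makes `Π_{n+1}'` a multiple of the
Christoffel–Darboux kernel `K_n(0, x)`. As `H_{2N+1}(0) = 0`, the kernel for `n = 2N` collapses to a
multiple of `H_{2N+1}(x) / x`, so the positive critical points are the positive zeros of `H_{2N+1}`;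
even degrees add no new term. At `x = t / (2√N)` the quotient becomes, up to a constant,
`hermiteSinc N t`, whose coefficients tend to those of `sinc`. Convergence is uniform on bounded
intervals, so the first rescaled zero tends to `π`, and Stirling gives the constant `2/π`.
Integrating `Π'` from `0` to that zero gives the limit. -/

/-! ### Recurrences and values at zero -/

theorem hermiteH_succ (n : ℕ) :
    hermiteH (n + 1) = 2 * X * hermiteH n - derivative (hermiteH n) := by
  rw [hermiteH]

theorem derivative_hermiteH_succ (n : ℕ) :
    derivative (hermiteH (n + 1)) = 2 * ((n : ℝ[X]) + 1) * hermiteH n := by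
  induction n with
  | zero => simp [hermiteH]
  | succ n ih =>
    rw [hermiteH_succ (n + 1), derivative_sub, ih]
    simp only [derivative_mul, derivative_ofNat, derivative_X, derivative_add, derivative_natCast,
      derivative_one, ih]
    rw [hermiteH_succ n]
    push_cast
    ring

theorem hermiteH_add_two (n : ℕ) :
    hermiteH (n + 2) = 2 * X * hermiteH (n + 1) - 2 * ((n : ℝ[X]) + 1) * hermiteH n := by
  rw [hermiteH_succ (n + 1), derivative_hermiteH_succ]

theorem eval_hermiteH_add_two (n : ℕ) (x : ℝ) :
    (hermiteH (n + 2)).eval x =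
      2 * x * (hermiteH (n + 1)).eval x - 2 * ((n : ℝ) + 1) * (hermiteH n).eval x := by
  rw [hermiteH_add_two]
  simp

theorem eval_derivative_hermiteH_succ (n : ℕ) (x : ℝ) :
    (derivative (hermiteH (n + 1))).eval x = 2 * ((n : ℝ) + 1) * (hermiteH n).eval x := by
  rw [derivative_hermiteH_succ]
  simp

theorem eval_zero_hermiteH_odd (n : ℕ) : (hermiteH (2 * n + 1)).eval 0 = 0 := by
  induction n with
  | zero => simp [hermiteH]
  | succ n ih =>
    rw [show 2 * (n + 1) + 1 = (2 * n + 1) + 2 by ring, eval_hermiteH_add_two, ih]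
    simp

theorem eval_zero_hermiteH_even (n : ℕ) :
    (hermiteH (2 * n)).eval 0 = (-1) ^ n * ((2 * n).factorial : ℝ) / n.factorial := by
  induction n with
  | zero => simp [hermiteH]
  | succ n ih =>
    rw [show 2 * (n + 1) = (2 * n) + 2 by ring, eval_hermiteH_add_two, ih, Nat.factorial_succ,
      Nat.factorial_succ, Nat.factorial_succ]
    push_cast
    field_simp
    ring

theorem eval_zero_hermiteH_mul_succ (n : ℕ) :
    (hermiteH n).eval 0 * (hermiteH (n + 1)).eval 0 = 0 := by
  obtain ⟨k, rfl | rfl⟩ := n.even_or_odd'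
  · rw [eval_zero_hermiteH_odd, mul_zero]
  · rw [eval_zero_hermiteH_odd, zero_mul]

/-! ### Gaussian integrals and the coefficients of the sign function -/

theorem tendsto_eval_mul_gaussian_atTop (p : ℝ[X]) :
    Tendsto (fun x : ℝ => p.eval x * Real.exp (-x ^ 2)) atTop (𝓝 0) := by
  induction p using Polynomial.induction_on' with
  | add p q hp hq => simpa [add_mul] using hp.add hq
  | monomial n a =>
    have h := (rpow_mul_exp_neg_mul_sq_isLittleO_exp_neg one_pos (n : ℝ)).tendsto_zero_of_tendsto
      (Real.tendsto_exp_atBot.comp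
        (tendsto_id.const_mul_atTop_of_neg (r := -(1 / 2 : ℝ)) (by norm_num)))
    simpa [mul_assoc] using h.const_mul a

theorem tendsto_eval_mul_gaussian_atBot (p : ℝ[X]) :
    Tendsto (fun x : ℝ => p.eval x * Real.exp (-x ^ 2)) atBot (𝓝 0) := by
  have h := (tendsto_eval_mul_gaussian_atTop (p.comp (-X))).comp tendsto_neg_atBot_atTop
  refine h.congr fun x => ?_
  simp

theorem integrable_eval_mul_gaussian (p : ℝ[X]) :
    Integrable (fun x : ℝ => p.eval x * Real.exp (-x ^ 2)) := by
  induction p using Polynomial.induction_on' with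
  | add p q hp hq =>
    simp only [eval_add, add_mul]
    exact hp.add hq
  | monomial n a =>
    have h := integrable_rpow_mul_exp_neg_mul_sq one_pos (s := n)
      (by have : (0 : ℝ) ≤ n := n.cast_nonneg
          linarith)
    simpa [mul_assoc] using h.const_mul a

theorem hasDerivAt_eval_mul_gaussian (p : ℝ[X]) (x : ℝ) :
    HasDerivAt (fun x : ℝ => p.eval x * Real.exp (-x ^ 2))
      (-((2 * X * p - derivative p).eval x * Real.exp (-x ^ 2))) x := by
  have h := (p.hasDerivAt x).mul (((hasDerivAt_id x).pow 2).neg.exp)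
  refine h.congr_deriv ?_
  simp
  ring

theorem integral_Ioi_eval_mul_gaussian (p : ℝ[X]) :
    ∫ x in Set.Ioi (0 : ℝ), (2 * X * p - derivative p).eval x * Real.exp (-x ^ 2) = p.eval 0 := by
  have h := integral_Ioi_of_hasDerivAt_of_tendsto' (a := 0)
    (fun x _ => hasDerivAt_eval_mul_gaussian p x)
    (integrable_eval_mul_gaussian _).neg.integrableOn (tendsto_eval_mul_gaussian_atTop p)
  rw [integral_neg] at h
  simpa using h

theorem integral_Iic_eval_mul_gaussian (p : ℝ[X]) :
    ∫ x in Set.Iic (0 : ℝ), (2 * X * p - derivative p).eval x * Real.exp (-x ^ 2) =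
      -p.eval 0 := by
  have h := integral_Iic_of_hasDerivAt_of_tendsto' (a := 0)
    (fun x _ => hasDerivAt_eval_mul_gaussian p x)
    (integrable_eval_mul_gaussian _).neg.integrableOn (tendsto_eval_mul_gaussian_atBot p)
  rw [integral_neg] at h
  simp at h ⊢
  linarith

theorem integral_eval_mul_gaussian (p : ℝ[X]) :
    ∫ x : ℝ, (2 * X * p - derivative p).eval x * Real.exp (-x ^ 2) = 0 := by
  have h := integral_of_hasDerivAt_of_tendsto (hasDerivAt_eval_mul_gaussian p)
    (integrable_eval_mul_gaussian _).neg (tendsto_eval_mul_gaussian_atBot p)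
    (tendsto_eval_mul_gaussian_atTop p)
  rw [integral_neg] at h
  simpa using h

theorem hermiteInner_hermiteH_self (n : ℕ) :
    hermiteInner (fun x => (hermiteH n).eval x) (fun x => (hermiteH n).eval x) =
      2 ^ n * n.factorial * √Real.pi := by
  induction n with
  | zero => simpa [hermiteInner, hermiteH] using integral_gaussian 1
  | succ n ih =>
    -- For `p = H_n H_{n+1}`, `2Xp - p' = H_{n+1}² - 2(n+1) H_n²`, which relates consecutive norms.
    have h := integral_eval_mul_gaussian (hermiteH n * hermiteH (n + 1))
    have e : ∀ x : ℝ, (2 * X * (hermiteH n * hermiteH (n + 1)) -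
        derivative (hermiteH n * hermiteH (n + 1))).eval x * Real.exp (-x ^ 2) =
        (hermiteH (n + 1) * hermiteH (n + 1)).eval x * Real.exp (-x ^ 2) -
          2 * ((n : ℝ) + 1) * ((hermiteH n * hermiteH n).eval x * Real.exp (-x ^ 2)) := fun x => by
      rw [derivative_mul, derivative_hermiteH_succ]
      nth_rw 4 [hermiteH_succ n]
      simp
      ring
    simp_rw [e] at h
    rw [integral_sub (integrable_eval_mul_gaussian _)
      ((integrable_eval_mul_gaussian _).const_mul _), integral_const_mul] at h
    simp only [hermiteInner, eval_mul] at h ih ⊢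
    rw [ih] at h
    rw [sub_eq_zero.1 h, Nat.factorial_succ]
    push_cast
    ring

theorem hermiteInner_sign_one :
    hermiteInner Real.sign (fun x => (hermiteH 0).eval x) = 0 := by
  have h := integral_neg_eq_self
    (fun x : ℝ => Real.sign x * (hermiteH 0).eval x * Real.exp (-x ^ 2)) volume
  simp only [Real.sign_neg, hermiteH, eval_one, neg_mul, integral_neg, neg_sq] at h
  simp only [hermiteInner, hermiteH, eval_one]
  linarith

/-- The integrand has antiderivative `∓H_n e^{-x²}` on the two half-lines; each contributes the
boundary term `H_n(0)`. -/
theorem hermiteInner_sign_succ (n : ℕ) :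
    hermiteInner Real.sign (fun x => (hermiteH (n + 1)).eval x) = 2 * (hermiteH n).eval 0 := by
  have hI := integrable_eval_mul_gaussian (hermiteH (n + 1))
  have e1 : Set.EqOn (fun x : ℝ => Real.sign x * (hermiteH (n + 1)).eval x * Real.exp (-x ^ 2))
      (fun x => (hermiteH (n + 1)).eval x * Real.exp (-x ^ 2)) (Set.Ioi 0) := fun x hx => by
    simp [Real.sign_of_pos hx]
  have e2 : Set.EqOn (fun x : ℝ => Real.sign x * (hermiteH (n + 1)).eval x * Real.exp (-x ^ 2))
      (fun x => -((hermiteH (n + 1)).eval x * Real.exp (-x ^ 2))) (Set.Iio 0) := fun x hx => by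
    simp [Real.sign_of_neg hx]
  rw [hermiteInner, ← setIntegral_univ, ← Set.Iic_union_Ioi (a := (0 : ℝ)),
    setIntegral_union (Set.Iic_disjoint_Ioi le_rfl) measurableSet_Ioi,
    integral_Iic_eq_integral_Iio, setIntegral_congr_fun measurableSet_Ioi e1,
    setIntegral_congr_fun measurableSet_Iio e2, ← integral_Iic_eq_integral_Iio, integral_neg,
    hermiteH_succ, integral_Ioi_eval_mul_gaussian, integral_Iic_eval_mul_gaussian]
  · ring
  · rw [integrableOn_Iic_iff_integrableOn_Iio]
    exact hI.neg.integrableOn.congr_fun (fun x hx => (e2 hx).symm) measurableSet_Iio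
  · exact hI.integrableOn.congr_fun (fun x hx => (e1 hx).symm) measurableSet_Ioi

theorem hermiteCoeff_sign_zero : hermiteCoeff Real.sign 0 = 0 := by
  rw [hermiteCoeff, hermiteInner_sign_one, zero_div]

theorem hermiteCoeff_sign_succ (n : ℕ) :
    hermiteCoeff Real.sign (n + 1) =
      2 * (hermiteH n).eval 0 / (2 ^ (n + 1) * (n + 1).factorial * √Real.pi) := by
  rw [hermiteCoeff, hermiteInner_sign_succ, hermiteInner_hermiteH_self]

/-! ### Existence of positive zeros -/

theorem not_forall_deriv_pos_of_tendsto_zero {f f' : ℝ → ℝ} {a : ℝ}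
    (hf : ∀ x, HasDerivAt f (f' x) x) (ha : f a = 0) (hlim : Tendsto f atTop (𝓝 0)) :
    ¬ ∀ x, a < x → 0 < f' x := by
  intro h
  have hm : StrictMonoOn f (Set.Ici a) :=
    strictMonoOn_of_deriv_pos (convex_Ici a) (fun x _ => (hf x).continuousAt.continuousWithinAt)
      fun x hx => by
        rw [(hf x).deriv]
        exact h x (by simpa using hx)
  have h1 : 0 < f (a + 1) := by
    rw [← ha]
    exact hm Set.self_mem_Ici (by simp) (by linarith)
  refine h1.not_ge (ge_of_tendsto hlim ?_)
  filter_upwards [eventually_ge_atTop (a + 1)] with x hx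
  exact hm.monotoneOn (by simp) (Set.mem_Ici.2 (by linarith)) hx

/-- Rolle's theorem on a half-line. -/
theorem exists_gt_hasDerivAt_eq_zero_of_tendsto {f f' : ℝ → ℝ} {a : ℝ}
    (hf : ∀ x, HasDerivAt f (f' x) x) (ha : f a = 0) (hlim : Tendsto f atTop (𝓝 0)) :
    ∃ b, a < b ∧ f' b = 0 := by
  by_contra! hne
  rcases hasDerivWithinAt_forall_lt_or_forall_gt_of_forall_ne (convex_Ioi a)
    (fun x _ => (hf x).hasDerivWithinAt) (m := 0) (fun x hx => hne x hx) with h | h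
  · exact not_forall_deriv_pos_of_tendsto_zero (f := fun x => -f x) (f' := fun x => -f' x) (a := a)
      (fun x => (hf x).neg) (by simp [ha]) (by simpa using hlim.neg)
      fun x hx => neg_pos.2 (h x hx)
  · exact not_forall_deriv_pos_of_tendsto_zero hf ha hlim h

/-- Rolle on `[a, ∞)` for `H_n e^{-x²}`, whose derivative is `-H_{n+1} e^{-x²}`. -/
theorem exists_gt_eval_hermiteH_succ_eq_zero {n : ℕ} {a : ℝ} (ha : (hermiteH n).eval a = 0) :
    ∃ b, a < b ∧ (hermiteH (n + 1)).eval b = 0 := by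
  obtain ⟨b, hab, hb⟩ := exists_gt_hasDerivAt_eq_zero_of_tendsto (a := a)
    (hasDerivAt_eval_mul_gaussian (hermiteH n)) (by simp [ha])
    (tendsto_eval_mul_gaussian_atTop _)
  refine ⟨b, hab, ?_⟩
  rw [← hermiteH_succ] at hb
  simpa [(Real.exp_pos _).ne'] using hb

theorem exists_pos_eval_hermiteH_eq_zero (n : ℕ) :
    ∃ b : ℝ, 0 < b ∧ (hermiteH (n + 2)).eval b = 0 := by
  induction n with
  | zero => exact exists_gt_eval_hermiteH_succ_eq_zero (by simpa using eval_zero_hermiteH_odd 0)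
  | succ n ih =>
    obtain ⟨a, ha, h⟩ := ih
    obtain ⟨b, hab, hb⟩ := exists_gt_eval_hermiteH_succ_eq_zero h
    exact ⟨b, ha.trans hab, hb⟩

/-! ### The derivative of the expansion -/

/-- The Christoffel–Darboux formula for the Hermite polynomials, with one argument zero. -/
theorem mul_sum_hermiteH_eval_zero_mul (n : ℕ) (x : ℝ) :
    x * ∑ j ∈ Finset.range (n + 1),
        (hermiteH j).eval 0 * (hermiteH j).eval x / (2 ^ j * j.factorial) =
      ((hermiteH (n + 1)).eval x * (hermiteH n).eval 0 -
        (hermiteH n).eval x * (hermiteH (n + 1)).eval 0) / (2 ^ (n + 1) * n.factorial) := by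
  induction n with
  | zero => simp [hermiteH]
  | succ n ih =>
    rw [Finset.sum_range_succ, mul_add, ih, eval_hermiteH_add_two n x, eval_hermiteH_add_two n 0,
      Nat.factorial_succ]
    push_cast
    field_simp
    ring

theorem hermiteExpansion_sign_zero (n : ℕ) : hermiteExpansion Real.sign n 0 = 0 := by
  refine Finset.sum_eq_zero fun j _ => ?_
  cases j with
  | zero => rw [hermiteCoeff_sign_zero, zero_mul]
  | succ j =>
    rw [hermiteCoeff_sign_succ, div_mul_eq_mul_div, mul_assoc, eval_zero_hermiteH_mul_succ]
    simp

theorem hermiteExpansion_sign_two_mul_add_two (N : ℕ) :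
    hermiteExpansion Real.sign (2 * N + 2) = hermiteExpansion Real.sign (2 * N + 1) := by
  ext x
  rw [hermiteExpansion, Finset.sum_range_succ, hermiteCoeff_sign_succ, eval_zero_hermiteH_odd]
  simp [hermiteExpansion]

theorem hermiteExpansion_sign_eq_odd {n : ℕ} (hn : 1 ≤ n) :
    hermiteExpansion Real.sign n = hermiteExpansion Real.sign (2 * ((n - 1) / 2) + 1) := by
  rcases Nat.mod_two_eq_zero_or_one n with h | h
  · rw [← hermiteExpansion_sign_two_mul_add_two]
    congr 1
    omega
  · congr 1
    omega

theorem hasDerivAt_hermiteExpansion_sign (n : ℕ) (x : ℝ) :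
    HasDerivAt (hermiteExpansion Real.sign (n + 1))
      (2 / √Real.pi * ∑ j ∈ Finset.range (n + 1),
        (hermiteH j).eval 0 * (hermiteH j).eval x / (2 ^ j * j.factorial)) x := by
  have h := HasDerivAt.fun_sum (u := Finset.range (n + 1 + 1)) fun j _ =>
    ((hermiteH j).hasDerivAt x).const_mul (hermiteCoeff Real.sign j)
  refine h.congr_deriv ?_
  rw [Finset.sum_range_succ', hermiteCoeff_sign_zero, zero_mul, add_zero, Finset.mul_sum]
  refine Finset.sum_congr rfl fun j _ => ?_
  have hpi : √Real.pi ≠ 0 := (Real.sqrt_pos.2 Real.pi_pos).ne'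
  rw [hermiteCoeff_sign_succ, eval_derivative_hermiteH_succ, Nat.factorial_succ]
  push_cast
  field_simp
  ring

theorem hasDerivAt_hermiteExpansion_sign_odd (N : ℕ) {x : ℝ} (hx : x ≠ 0) :
    HasDerivAt (hermiteExpansion Real.sign (2 * N + 1))
      ((-1) ^ N / (√Real.pi * 4 ^ N * N.factorial) * ((hermiteH (2 * N + 1)).eval x / x)) x := by
  refine (hasDerivAt_hermiteExpansion_sign (2 * N) x).congr_deriv ?_
  have h := mul_sum_hermiteH_eval_zero_mul (2 * N) x
  rw [eval_zero_hermiteH_odd, eval_zero_hermiteH_even] at h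
  rw [mul_comm, ← eq_div_iff hx] at h
  rw [h]
  have hpi : √Real.pi ≠ 0 := (Real.sqrt_pos.2 Real.pi_pos).ne'
  rw [show (4 : ℝ) ^ N = 2 ^ (2 * N) by rw [pow_mul]; norm_num]
  field_simp
  ring

/-! ### Explicit coefficients -/

/-- Iterating `H_{n+1}' = 2(n+1) H_n` reduces every coefficient to a constant term. -/
theorem coeff_hermiteH_add (k m : ℕ) :
    (hermiteH (k + m)).coeff k = 2 ^ k * (k + m).choose k * (hermiteH m).eval 0 := by
  induction k with
  | zero => simp [coeff_zero_eq_eval_zero]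
  | succ k ih =>
    have h := congrArg (fun p => p.coeff k) (derivative_hermiteH_succ (k + m))
    have e : (2 * (((k + m : ℕ) : ℝ[X]) + 1) * hermiteH (k + m)).coeff k =
        2 * ((k + m : ℕ) + 1) * (hermiteH (k + m)).coeff k := by
      rw [← coeff_C_mul]
      simp [C_ofNat]
    simp only [coeff_derivative, e, ih] at h
    have hc := Nat.add_one_mul_choose_eq (k + m) k
    rw [show k + 1 + m = k + m + 1 by ring]
    have hc' : ((k + m : ℕ) + 1 : ℝ) * (k + m).choose k =
        (k + m + 1).choose (k + 1) * (k + 1) := by exact_mod_cast hc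
    have hk : (k + 1 : ℝ) ≠ 0 := by positivity
    apply mul_right_cancel₀ hk
    rw [h]
    linear_combination 2 * 2 ^ k * (hermiteH m).eval 0 * hc'

theorem natDegree_hermiteH_le (n : ℕ) : (hermiteH n).natDegree ≤ n := by
  induction n with
  | zero => simp [hermiteH]
  | succ n ih =>
    rw [hermiteH_succ]
    refine (natDegree_sub_le _ _).trans (max_le ?_ ?_)
    · refine natDegree_mul_le.trans ?_
      have : (2 * X : ℝ[X]).natDegree ≤ 1 := by
        simp
      omega
    · have := natDegree_derivative_le (hermiteH n)
      omega

theorem sum_range_two_mul_eq {M : Type*} [AddCommMonoid M] (f : ℕ → M) (n : ℕ) :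
    ∑ i ∈ Finset.range (2 * n), f i = ∑ i ∈ Finset.range n, (f (2 * i) + f (2 * i + 1)) := by
  induction n with
  | zero => simp
  | succ n ih =>
    rw [Finset.sum_range_succ, ← ih, show 2 * (n + 1) = 2 * n + 1 + 1 by ring,
      Finset.sum_range_succ, Finset.sum_range_succ, add_assoc]

theorem eval_hermiteH_odd (N : ℕ) (x : ℝ) :
    (hermiteH (2 * N + 1)).eval x =
      ∑ k ∈ Finset.range (N + 1), (-1) ^ (N - k) * (2 * N + 1).factorial /
        ((2 * k + 1).factorial * (N - k).factorial) * (2 * x) ^ (2 * k + 1) := by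
  rw [eval_eq_sum_range' (n := 2 * (N + 1)) (by have := natDegree_hermiteH_le (2 * N + 1); omega),
    sum_range_two_mul_eq]
  refine Finset.sum_congr rfl fun k hk => ?_
  obtain ⟨m, rfl⟩ := Nat.exists_eq_add_of_le (Nat.lt_succ_iff.1 (Finset.mem_range.1 hk))
  have h1 := coeff_hermiteH_add (2 * k) (2 * m + 1)
  have h2 := coeff_hermiteH_add (2 * k + 1) (2 * m)
  rw [eval_zero_hermiteH_odd, show 2 * k + (2 * m + 1) = 2 * (k + m) + 1 by ring] at h1
  rw [eval_zero_hermiteH_even, Nat.cast_add_choose,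
    show 2 * k + 1 + 2 * m = 2 * (k + m) + 1 by ring] at h2
  rw [h1, h2, Nat.add_sub_cancel_left]
  field_simp
  ring

/-! ### Rescaling and the `sinc` limit -/

/-- The Hermite polynomial `H_{2N+1}` rescaled so as to converge to the function `sinc`. -/
noncomputable def hermiteSinc (N : ℕ) (t : ℝ) : ℝ :=
  ∑ k ∈ Finset.range (N + 1),
    (N.descFactorial k : ℝ) / (N : ℝ) ^ k * ((-1) ^ k * t ^ (2 * k) / (2 * k + 1).factorial)

theorem continuous_hermiteSinc (N : ℕ) : Continuous (hermiteSinc N) := by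
  unfold hermiteSinc
  fun_prop

theorem hermiteSinc_zero_right (N : ℕ) : hermiteSinc N 0 = 1 := by
  rw [hermiteSinc, Finset.sum_range_succ']
  simp

theorem hasSum_hermiteSinc (N : ℕ) (t : ℝ) :
    HasSum (fun k : ℕ =>
      (N.descFactorial k : ℝ) / (N : ℝ) ^ k * ((-1) ^ k * t ^ (2 * k) / (2 * k + 1).factorial))
      (hermiteSinc N t) := by
  refine hasSum_sum_of_ne_finset_zero fun k hk => ?_
  -- The falling factorial vanishes for `k > N`, so the finite sum is a full series, comparable
  -- termwise with `sinc`.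
  rw [Nat.descFactorial_eq_zero_iff_lt.2 (by simpa [Nat.lt_succ_iff] using hk)]
  simp

theorem hasSum_sinc (t : ℝ) :
    HasSum (fun k : ℕ => (-1) ^ k * t ^ (2 * k) / ((2 * k + 1).factorial : ℝ)) (Real.sinc t) := by
  rcases eq_or_ne t 0 with rfl | ht
  · rw [Real.sinc_zero]
    convert hasSum_single (α := ℝ) 0 ?_
    · simp
    · intro k hk
      simp [hk]
  · rw [Real.sinc_of_ne_zero ht]
    have h := (Real.hasSum_sin t).div_const t
    convert! h using 2 with k
    rw [pow_succ, div_right_comm, ← mul_assoc, mul_div_assoc _ t t, div_self ht, mul_one]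

theorem descFactorial_div_pow_le_one (N k : ℕ) : (N.descFactorial k : ℝ) / (N : ℝ) ^ k ≤ 1 :=
  div_le_one_of_le₀ (by exact_mod_cast Nat.descFactorial_le_pow N k) (by positivity)

theorem tendsto_descFactorial_div_pow (k : ℕ) :
    Tendsto (fun N : ℕ => (N.descFactorial k : ℝ) / (N : ℝ) ^ k) atTop (𝓝 1) := by
  refine (Asymptotics.isEquivalent_iff_tendsto_one ?_).1 (isEquivalent_descFactorial k)
  filter_upwards [eventually_ne_atTop 0] with N hN
  positivity

theorem summable_pow_div_factorial_odd (R : ℝ) :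
    Summable fun k : ℕ => R ^ (2 * k) / ((2 * k + 1).factorial : ℝ) := by
  refine (hasSum_sinc R).summable.norm.congr fun k => ?_
  simp [pow_mul]

/-- On `[0, R]` the error is at most the series of coefficient defects taken at `R`, which tends to
`0` by dominated convergence. -/
theorem tendstoUniformlyOn_hermiteSinc (R : ℝ) :
    TendstoUniformlyOn hermiteSinc Real.sinc atTop (Set.Icc 0 R) := by
  have hlim : Tendsto (fun N : ℕ => ∑' k : ℕ, (1 - (N.descFactorial k : ℝ) / (N : ℝ) ^ k) *
      (R ^ (2 * k) / ((2 * k + 1).factorial : ℝ))) atTop (𝓝 0) := by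
    have h := tendsto_tsum_of_dominated_convergence (𝓕 := atTop)
      (f := fun N k : ℕ => (1 - (N.descFactorial k : ℝ) / (N : ℝ) ^ k) *
        (R ^ (2 * k) / ((2 * k + 1).factorial : ℝ))) (g := fun _ => 0)
      (summable_pow_div_factorial_odd R) ?_ ?_
    · simpa using h
    · intro k
      simpa using ((tendsto_descFactorial_div_pow k).const_sub 1).mul_const
        (R ^ (2 * k) / ((2 * k + 1).factorial : ℝ))
    · refine Eventually.of_forall fun N k => ?_
      have h0 : 0 ≤ R ^ (2 * k) / ((2 * k + 1).factorial : ℝ) := by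
        rw [pow_mul]
        positivity
      have h1 := descFactorial_div_pow_le_one N k
      have h2 : (0 : ℝ) ≤ (N.descFactorial k : ℝ) / (N : ℝ) ^ k := by positivity
      rw [Real.norm_of_nonneg (mul_nonneg (by linarith) h0)]
      exact mul_le_of_le_one_left h0 (by linarith)
  rw [Metric.tendstoUniformlyOn_iff]
  intro ε hε
  filter_upwards [hlim.eventually_lt_const hε] with N hN t ht
  refine lt_of_le_of_lt ?_ hN
  have hs := (hasSum_sinc t).sub (hasSum_hermiteSinc N t)
  rw [Real.dist_eq, ← hs.tsum_eq, ← Real.norm_eq_abs]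
  have hle : ∀ k : ℕ, 0 ≤ 1 - (N.descFactorial k : ℝ) / (N : ℝ) ^ k := fun k =>
    sub_nonneg.2 (descFactorial_div_pow_le_one N k)
  have hR : 0 ≤ R := ht.1.trans ht.2
  refine tsum_of_norm_bounded (Summable.hasSum ?_) fun k => ?_
  · refine (summable_pow_div_factorial_odd R).of_nonneg_of_le
      (fun k => mul_nonneg (hle k) (by positivity)) fun k => ?_
    refine mul_le_of_le_one_left (by positivity) ?_
    have h2 : (0 : ℝ) ≤ (N.descFactorial k : ℝ) / (N : ℝ) ^ k := by positivity
    linarith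
  · rw [← one_sub_mul, norm_mul, Real.norm_of_nonneg (hle k)]
    refine mul_le_mul_of_nonneg_left ?_ (hle k)
    rw [norm_div, norm_mul, norm_pow, norm_pow, norm_neg, norm_one, one_pow, one_mul,
      Real.norm_of_nonneg ht.1, Real.norm_of_nonneg (Nat.cast_nonneg _)]
    have := pow_le_pow_left₀ ht.1 ht.2 (2 * k)
    gcongr

theorem eval_hermiteH_odd_eq_hermiteSinc {N : ℕ} (hN : 0 < N) (t : ℝ) :
    (hermiteH (2 * N + 1)).eval (t / (2 * √N)) =
      (-1) ^ N * (2 * N + 1).factorial / N.factorial * (t / √N) * hermiteSinc N t := by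
  have hs : 0 < √(N : ℝ) := Real.sqrt_pos.2 (by exact_mod_cast hN)
  rw [eval_hermiteH_odd, hermiteSinc, Finset.mul_sum]
  refine Finset.sum_congr rfl fun k hk => ?_
  have hk' := Nat.lt_succ_iff.1 (Finset.mem_range.1 hk)
  have hf : ((N - k).factorial : ℝ) * N.descFactorial k = N.factorial := by
    exact_mod_cast Nat.factorial_mul_descFactorial hk'
  have hsq : (N : ℝ) ^ k = √(N : ℝ) ^ (2 * k) := by
    rw [pow_mul, Real.sq_sqrt (Nat.cast_nonneg N)]
  have hsign : (-1 : ℝ) ^ (N - k) = (-1) ^ N * (-1) ^ k := by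
    obtain ⟨m, rfl⟩ := Nat.exists_eq_add_of_le hk'
    rw [Nat.add_sub_cancel_left, pow_add, mul_comm, ← mul_assoc, ← mul_pow]
    simp
  rw [hsign, ← hf, hsq, show 2 * (t / (2 * √(N : ℝ))) = t / √N by field_simp, pow_succ, div_pow]
  have hd : (N.descFactorial k : ℝ) ≠ 0 := by
    exact_mod_cast fun h => (Nat.descFactorial_eq_zero_iff_lt.1 h).not_ge hk'
  field_simp

/-- The derivative at `0` of the expansion of the sign function, in the variable of
`hermiteSinc`. -/
noncomputable def hermiteSincScale (N : ℕ) : ℝ :=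
  (2 * N + 1).factorial / (√Real.pi * √N * 4 ^ N * (N.factorial : ℝ) ^ 2)

theorem tendsto_hermiteSincScale : Tendsto hermiteSincScale atTop (𝓝 (2 / Real.pi)) := by
  have hpi : 0 < √Real.pi := Real.sqrt_pos.2 Real.pi_pos
  have hS := Stirling.tendsto_stirlingSeq_sqrt_pi
  have h2 : Tendsto (fun N : ℕ => 2 * N) atTop atTop :=
    tendsto_id.const_mul_atTop' (by norm_num)
  -- With `S` the Stirling sequence, the scale is exactly `S(2N) / S(N)² / √π * (2 + 1/N)`.
  have h := ((hS.comp h2).div (hS.pow 2) (by positivity)).div_const √Real.pi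
  have h1 : Tendsto (fun N : ℕ => 2 + 1 / (N : ℝ)) atTop (𝓝 2) := by
    simpa using tendsto_one_div_atTop_nhds_zero_nat.const_add (2 : ℝ)
  have h' := h.mul h1
  have e : √Real.pi / √Real.pi ^ 2 / √Real.pi * 2 = 2 / Real.pi := by
    rw [div_div, div_mul_eq_mul_div, div_eq_div_iff (by positivity) Real.pi_pos.ne']
    nth_rw 2 [← Real.sq_sqrt Real.pi_pos.le]
    ring
  rw [e] at h'
  refine h'.congr' ?_
  filter_upwards [eventually_gt_atTop 0] with N hN
  have hN' : (0 : ℝ) < N := by exact_mod_cast hN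
  have hs : 0 < √(N : ℝ) := Real.sqrt_pos.2 hN'
  have hs2 : √(N : ℝ) ^ 2 = N := Real.sq_sqrt hN'.le
  have e1 : √(2 * ((2 * N : ℕ) : ℝ)) = 2 * √N := by
    push_cast
    rw [show (2 : ℝ) * (2 * N) = 2 ^ 2 * N by ring, Real.sqrt_mul (by positivity),
      Real.sqrt_sq (by norm_num)]
  have e2 : √(2 * (N : ℝ)) ^ 2 = 2 * √(N : ℝ) ^ 2 := by
    rw [Real.sq_sqrt (by positivity), hs2]
  have e4 : (4 : ℝ) ^ N = 2 ^ (2 * N) := by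
    rw [pow_mul]
    norm_num
  have hE : 0 < Real.exp 1 := Real.exp_pos 1
  simp only [Pi.div_apply, Function.comp_apply, Stirling.stirlingSeq,
    hermiteSincScale]
  rw [e1, e4, Nat.factorial_succ, div_pow _ _ 2, mul_pow, e2, ← pow_mul, mul_comm N 2]
  push_cast
  rw [div_pow, div_pow, mul_pow]
  field_simp
  rw [hs2]

theorem hermiteExpansion_sign_odd_eq_integral {N : ℕ} (hN : 0 < N) {t : ℝ} (ht : 0 ≤ t) :
    hermiteExpansion Real.sign (2 * N + 1) (t / (2 * √N)) =
      hermiteSincScale N * ∫ s in (0 : ℝ)..t, hermiteSinc N s := by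
  have hs : 0 < √(N : ℝ) := Real.sqrt_pos.2 (by exact_mod_cast hN)
  have hpi : 0 < √Real.pi := Real.sqrt_pos.2 Real.pi_pos
  -- The derivative formula divides by `x`, so it is used only on the open interval, with continuity
  -- at the endpoints.
  have h := intervalIntegral.integral_eq_sub_of_hasDerivAt_of_le
    (f := fun s => hermiteExpansion Real.sign (2 * N + 1) (s / (2 * √N)))
    (f' := fun s => hermiteSincScale N * hermiteSinc N s) ht ?_ ?_ ?_
  · rw [← intervalIntegral.integral_const_mul, h, zero_div, hermiteExpansion_sign_zero, sub_zero]
  · refine Continuous.continuousOn ?_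
    simp only [hermiteExpansion]
    fun_prop
  · intro s hs0
    have hs0 : 0 < s := hs0.1
    have hd := (hasDerivAt_hermiteExpansion_sign_odd N (x := s / (2 * √N)) (by positivity)).comp s
      ((hasDerivAt_id s).div_const (2 * √N))
    refine hd.congr_deriv ?_
    rw [eval_hermiteH_odd_eq_hermiteSinc hN, hermiteSincScale]
    have hsign : ((-1 : ℝ) ^ N) ^ 2 = 1 := by
      rw [← pow_mul, mul_comm, pow_mul]
      simp
    field_simp
    rw [hsign]
    ring
  · exact ((continuous_hermiteSinc N).const_mul _).intervalIntegrable _ _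

/-! ### Smallest critical points and the limit -/

theorem isSmallestPosCriticalPoint_hermiteExpansion_sign_iff {n : ℕ} (hn : 1 ≤ n) {x : ℝ} :
    IsSmallestPosCriticalPoint (hermiteExpansion Real.sign n) x ↔
      IsLeast {y : ℝ | 0 < y ∧ (hermiteH (2 * ((n - 1) / 2) + 1)).eval y = 0} x := by
  rw [IsSmallestPosCriticalPoint, hermiteExpansion_sign_eq_odd hn]
  congr! 3 with y
  refine and_congr_right fun hy => ?_
  have h := hasDerivAt_hermiteExpansion_sign_odd ((n - 1) / 2) hy.ne'
  have hpi : √Real.pi ≠ 0 := (Real.sqrt_pos.2 Real.pi_pos).ne'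
  rw [h.deriv]
  simp [h.differentiableAt, hy.ne', hpi, Nat.factorial_ne_zero]

theorem exists_isLeast_pos_root {p : ℝ[X]} (hp : p ≠ 0) (h : ∃ x : ℝ, 0 < x ∧ p.eval x = 0) :
    ∃ x : ℝ, IsLeast {y : ℝ | 0 < y ∧ p.eval y = 0} x := by
  have hfin : {y : ℝ | 0 < y ∧ p.eval y = 0}.Finite :=
    (p.rootSet_finite ℝ).subset fun y hy => by
      rw [mem_rootSet]
      exact ⟨hp, by simpa using hy.2⟩
  exact hfin.exists_minimal h |>.imp fun x hx => ⟨hx.1, fun y hy => (le_total x y).elim id (hx.2 hy)⟩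

theorem hermiteH_ne_zero (n : ℕ) : hermiteH n ≠ 0 := by
  intro h
  have h1 := coeff_hermiteH_add n 0
  have h2 : (2 : ℝ) ^ n ≠ 0 := by positivity
  exact h2 (by simpa [h, hermiteH] using h1.symm)

/-- The least positive zeros of `hermiteSinc N` converge to the least positive zero of `sinc`. -/
theorem tendsto_isLeast_hermiteSinc_eq_zero {N : ℕ → ℕ} {t : ℕ → ℝ} (hN : Tendsto N atTop atTop)
    (ht : ∀ᶠ n in atTop, IsLeast {y : ℝ | 0 < y ∧ hermiteSinc (N n) y = 0} (t n)) :
    Tendsto t atTop (𝓝 Real.pi) := by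
  refine tendsto_order.2 ⟨fun a ha => ?_, fun b hb => ?_⟩
  -- On `[0, c]`, `sinc` has a positive minimum, so uniform closeness excludes zeros there.
  · obtain ⟨c, hc0, hac, hcpi⟩ : ∃ c, 0 ≤ c ∧ a ≤ c ∧ c < Real.pi :=
      ⟨max 0 a, le_max_left _ _, le_max_right _ _, max_lt Real.pi_pos ha⟩
    obtain ⟨z, hz, hmin⟩ := isCompact_Icc.exists_isMinOn (Set.nonempty_Icc.2 hc0)
      Real.continuous_sinc.continuousOn
    have hzpos : 0 < Real.sinc z := by
      rcases hz.1.eq_or_lt with h | h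
      · simp [← h]
      · rw [Real.sinc_of_ne_zero h.ne']
        exact div_pos (Real.sin_pos_of_pos_of_lt_pi h (hz.2.trans_lt hcpi)) h
    have hu := hN.eventually
      (Metric.tendstoUniformlyOn_iff.1 (tendstoUniformlyOn_hermiteSinc c) _ hzpos)
    filter_upwards [hu, ht] with n hn hl
    by_contra! hle
    have h1 := hn (t n) ⟨hl.1.1.le, hle.trans hac⟩
    rw [hl.1.2, Real.dist_eq, sub_zero] at h1
    have h2 := hmin (show t n ∈ Set.Icc 0 c from ⟨hl.1.1.le, hle.trans hac⟩)
    exact (h1.trans_le h2).not_ge (le_abs_self _)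
  -- The bound `2π` makes `sinc c < 0`; as `hermiteSinc` is `1` at `0`, a zero lies before `c`.
  · obtain ⟨c, hpc, hc⟩ : ∃ c, Real.pi < c ∧ c < min b (2 * Real.pi) :=
      exists_between (lt_min hb (by linarith [Real.pi_pos]))
    have hcb := hc.trans_le (min_le_left _ _)
    have hc2 := hc.trans_le (min_le_right _ _)
    have hc0 : 0 < c := Real.pi_pos.trans hpc
    have hneg : Real.sinc c < 0 := by
      rw [Real.sinc_of_ne_zero hc0.ne']
      refine div_neg_of_neg_of_pos ?_ hc0
      have := Real.sin_pos_of_pos_of_lt_pi (x := c - Real.pi) (by linarith) (by linarith)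
      rw [Real.sin_sub_pi] at this
      linarith
    have hp := hN.eventually (((tendstoUniformlyOn_hermiteSinc c).tendsto_at
      (Set.right_mem_Icc.2 hc0.le)).eventually_lt_const hneg)
    filter_upwards [hp, ht] with n hn hl
    obtain ⟨y, hy, hy0⟩ := intermediate_value_Icc' hc0.le
      (continuous_hermiteSinc (N n)).continuousOn
      (show (0 : ℝ) ∈ Set.Icc _ _ from ⟨hn.le, by rw [hermiteSinc_zero_right]; exact zero_le_one⟩)
    have hypos : 0 < y := hy.1.lt_of_ne fun h => by
      rw [← h, hermiteSinc_zero_right] at hy0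
      exact one_ne_zero hy0
    exact ((hl.2 ⟨hypos, hy0⟩).trans hy.2).trans_lt hcb

theorem tendsto_integral_of_tendstoUniformlyOn {F : ℕ → ℝ → ℝ} {f : ℝ → ℝ} {t : ℕ → ℝ} {T R : ℝ}
    (hF : ∀ n, Continuous (F n)) (hf : Continuous f) (hu : TendstoUniformlyOn F f atTop (Set.Icc 0 R))
    (ht : Tendsto t atTop (𝓝 T)) (hT : 0 < T) (hTR : T < R) :
    Tendsto (fun n => ∫ s in (0 : ℝ)..t n, F n s) atTop (𝓝 (∫ s in (0 : ℝ)..T, f s)) := by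
  have h1 : Tendsto (fun n => ∫ s in (0 : ℝ)..t n, f s) atTop (𝓝 (∫ s in (0 : ℝ)..T, f s)) :=
    ((intervalIntegral.continuous_primitive (fun a b => hf.intervalIntegrable a b) 0).tendsto T).comp
      ht
  have h2 : Tendsto (fun n => ∫ s in (0 : ℝ)..t n, (F n s - f s)) atTop (𝓝 0) := by
    rw [Metric.tendsto_nhds]
    intro ε hε
    have hR : 0 < R := hT.trans hTR
    filter_upwards [Metric.tendstoUniformlyOn_iff.1 hu (ε / (2 * R)) (by positivity),
      ht.eventually_const_lt hT, ht.eventually_lt_const hTR] with n hn h0 hlt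
    rw [dist_zero_right]
    refine (intervalIntegral.norm_integral_le_of_norm_le_const (C := ε / (2 * R)) ?_).trans_lt ?_
    · intro s hs
      rw [Set.uIoc_of_le h0.le] at hs
      rw [← dist_eq_norm, dist_comm]
      exact (hn s ⟨hs.1.le, hs.2.trans hlt.le⟩).le
    · rw [sub_zero, abs_of_pos h0]
      calc ε / (2 * R) * t n ≤ ε / (2 * R) * R := by gcongr
        _ = ε / 2 := by field_simp
        _ < ε := half_lt_self hε
  have h3 := h2.add h1
  rw [zero_add] at h3
  refine h3.congr fun n => ?_
  rw [intervalIntegral.integral_sub ((hF n).intervalIntegrable _ _) (hf.intervalIntegrable _ _),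
    sub_add_cancel]

theorem integral_sinc (T : ℝ) :
    ∫ t in (0 : ℝ)..T, Real.sinc t = ∫ t in (0 : ℝ)..T, Real.sin t / t := by
  refine intervalIntegral.integral_congr_ae ?_
  filter_upwards [compl_mem_ae_iff.2 (measure_singleton (0 : ℝ))] with t ht _
  exact Real.sinc_of_ne_zero ht

theorem isLeast_hermiteSinc_of_isLeast_hermiteH {N : ℕ} (hN : 0 < N) {x : ℝ}
    (h : IsLeast {y : ℝ | 0 < y ∧ (hermiteH (2 * N + 1)).eval y = 0} x) :
    IsLeast {y : ℝ | 0 < y ∧ hermiteSinc N y = 0} (2 * √N * x) := by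
  have hs : 0 < √(N : ℝ) := Real.sqrt_pos.2 (by exact_mod_cast hN)
  have hiff : ∀ y : ℝ, 0 < y →
      ((hermiteH (2 * N + 1)).eval (y / (2 * √N)) = 0 ↔ hermiteSinc N y = 0) := fun y hy => by
    rw [eval_hermiteH_odd_eq_hermiteSinc hN]
    simp [hy.ne', hs.ne', Nat.factorial_ne_zero]
  have hx : 0 < x := h.1.1
  refine ⟨⟨by positivity, ?_⟩, fun y hy => ?_⟩
  · rw [← hiff _ (by positivity), mul_div_cancel_left₀ _ (by positivity)]
    exact h.1.2
  · have := h.2 ⟨div_pos hy.1 (by positivity), (hiff y hy.1).2 hy.2⟩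
    rwa [le_div_iff₀ (by positivity), mul_comm] at this

theorem tendsto_hermiteExpansion_sign_isLeast {y : ℕ → ℝ}
    (hy : ∀ N : ℕ, 0 < N →
      IsLeast {y : ℝ | 0 < y ∧ (hermiteH (2 * N + 1)).eval y = 0} (y N)) :
    Tendsto (fun N : ℕ => hermiteExpansion Real.sign (2 * N + 1) (y N)) atTop
      (𝓝 (2 / Real.pi * ∫ t in (0 : ℝ)..Real.pi, Real.sin t / t)) := by
  have ht : Tendsto (fun N : ℕ => 2 * √(N : ℝ) * y N) atTop (𝓝 Real.pi) :=
    tendsto_isLeast_hermiteSinc_eq_zero tendsto_id <| by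
      filter_upwards [eventually_gt_atTop 0] with N hN
      exact isLeast_hermiteSinc_of_isLeast_hermiteH hN (hy N hN)
  have hI := tendsto_hermiteSincScale.mul
    (tendsto_integral_of_tendstoUniformlyOn continuous_hermiteSinc Real.continuous_sinc
      (tendstoUniformlyOn_hermiteSinc (Real.pi + 1)) ht Real.pi_pos (by linarith))
  rw [integral_sinc] at hI
  refine hI.congr' ?_
  filter_upwards [eventually_gt_atTop 0] with N hN
  have hs : 0 < √(N : ℝ) := Real.sqrt_pos.2 (by exact_mod_cast hN)
  have hy0 : 0 < y N := (hy N hN).1.1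
  rw [← hermiteExpansion_sign_odd_eq_integral hN (by positivity),
    mul_div_cancel_left₀ _ (by positivity)]

theorem theorem2 :
    (∀ n : ℕ, 3 ≤ n →
      ∃ x : ℝ, IsSmallestPosCriticalPoint (hermiteExpansion Real.sign n) x) ∧
    ∀ x : ℕ → ℝ,
      (∀ n : ℕ, 3 ≤ n → IsSmallestPosCriticalPoint (hermiteExpansion Real.sign n) (x n)) →
      Tendsto (fun n : ℕ => hermiteExpansion Real.sign n (x n)) atTop
        (𝓝 (2 / Real.pi * ∫ t in (0 : ℝ)..Real.pi, Real.sin t / t)) := by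
  constructor
  · intro n hn
    simp_rw [isSmallestPosCriticalPoint_hermiteExpansion_sign_iff (show 1 ≤ n by omega)]
    refine exists_isLeast_pos_root (hermiteH_ne_zero _) ?_
    -- Here `n ≥ 3` matters: it makes the odd degree at least `3`, and `H_1` has no positive zero.
    convert exists_pos_eval_hermiteH_eq_zero (2 * ((n - 1) / 2) - 1) using 6
    omega
  · intro x hx
    have hleast : ∀ n, 3 ≤ n →
        IsLeast {y : ℝ | 0 < y ∧ (hermiteH (2 * ((n - 1) / 2) + 1)).eval y = 0} (x n) :=
      fun n hn => (isSmallestPosCriticalPoint_hermiteExpansion_sign_iff (by omega)).1 (hx n hn)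
    have hdiv : ∀ N : ℕ, (2 * N + 1 - 1) / 2 = N := fun N => by omega
    have hlim := tendsto_hermiteExpansion_sign_isLeast (y := fun N => x (2 * N + 1)) fun N hN => by
      have h := hleast (2 * N + 1) (by omega)
      rwa [hdiv] at h
    have hhalf : Tendsto (fun n : ℕ => (n - 1) / 2) atTop atTop :=
      (Nat.tendsto_div_const_atTop two_ne_zero).comp (tendsto_sub_atTop_nat 1)
    refine (hlim.comp hhalf).congr' ?_
    filter_upwards [eventually_ge_atTop 3] with n hn
    have h := hleast (2 * ((n - 1) / 2) + 1) (by omega)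
    rw [hdiv] at h
    -- Least zeros are unique, so `x n` depends only on `(n - 1) / 2` and the odd subsequence
    -- suffices.
    rw [Function.comp_apply, h.unique (hleast n hn), ← hermiteExpansion_sign_eq_odd (by omega)]
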